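/- Let $q\ge 1$ be an integer and $d\in\{2,3\}$, and let $G=(V,E)$ be the grid graph with vertex set $V=\{0,1,\dots,q-1\}^d$, where two vertices are adjacent if and only if their $\ell_1$-distance is $1$; put $n=|V|=q^d$ and $p=|E|=d\,q^{d-1}(q-1)$. Let $\partial$ be the $(q-1)\times q$ matrix with $(\partial u)_i=u_{i+1}-u_i$, let $I$ be the $q\times q$ identity matrix, and let $\nabla\in\mathbb R^{p\times n}$ be the discrete gradient $$\nabla=\begin{pmatrix}\partial\otimes I\\ I\otimes\partial\end{pmatrix}\ (d=2),\qquad \nabla=\begin{pmatrix}\partial\otimes I\otimes I\\ I\otimes\partial\otimes I\\ I\otimes I\otimes\partial\end{pmatrix}\ (d=3),$$ whose rows correspond to the edges of $G$. For a set $\Lambda$ of rows let $\nabla_\Lambda$ be the submatrix of $\nabla$ formed by the rows in $\Lambda$, let $\mathcal W_\Lambda=\{u\in\mathbb R^n:\nabla_\Lambda u=0\}$, and for integers $0\le\ell\le p$ define $$\kappa_\nabla(\ell)=\max_{|\Lambda|\ge \ell}\dim\mathcal W_\Lambda .$$ Then: 1. if $d=2$, for every integer $\ell$ with $4<\ell\le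 p$, $$\kappa_\nabla(\ell)\le n-\tfrac12\bigl(\ell+\sqrt{1+2\ell}\bigr)+\tfrac12;$$ 2. if $d=3$, for every integer $\ell$ with $54<\ell\le p$, $$\kappa_\nabla(\ell)\le n-\tfrac13\Bigl(\ell+\sqrt[3]{3\ell^2}+2\sqrt[3]{\ell/3}\Bigr)+\tfrac23 .$$ -/

import Mathlib

open scoped Kronecker

noncomputable section

namespace GridGradient

/-- The subspace `W_Λ = N(B_Λ)`: the null space of the submatrix of `B` formed by the rows
indexed by `Λ`. -/
def cosupportSubspace {P N : Type*} [Fintype N] (B : Matrix P N ℝ) (Λ : Finset P) :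
    Submodule ℝ (N → ℝ) :=
  LinearMap.ker (B.submatrix (fun r : {r // r ∈ Λ} => (r : P)) id).mulVecLin

/-- `κ_B(ℓ) = max_{|Λ| ≥ ℓ} dim W_Λ`, where `Λ` ranges over the sets of row indices of `B`.
The maximum is over a nonempty set exactly when `ℓ` is at most the number of rows. -/
def kappa {P N : Type*} [Fintype P] [Fintype N] (B : Matrix P N ℝ) (ℓ : ℕ) : ℕ :=
  (Finset.univ.filter (fun Λ : Finset P => ℓ ≤ Λ.card)).sup
    (fun Λ => Module.finrank ℝ (cosupportSubspace B Λ))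

/-- If `ℓ` is at most the number of rows of `B`, then `kappa B ℓ` is an attained maximum. -/
theorem kappa_isGreatest {P N : Type*} [Fintype P] [Fintype N] (B : Matrix P N ℝ) (ℓ : ℕ)
    (hℓ : ℓ ≤ Fintype.card P) :
    IsGreatest {k : ℕ | ∃ Λ : Finset P, ℓ ≤ Λ.card ∧
      Module.finrank ℝ (cosupportSubspace B Λ) = k} (kappa B ℓ) := by
  constructor
  · have hne : (Finset.univ.filter (fun Λ : Finset P => ℓ ≤ Λ.card)).Nonempty :=
      ⟨Finset.univ, by simpa using hℓ⟩
    obtain ⟨Λ, hΛ, h⟩ := Finset.exists_mem_eq_sup _ hne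
      (fun Λ => Module.finrank ℝ (cosupportSubspace B Λ))
    exact ⟨Λ, (Finset.mem_filter.mp hΛ).2, h.symm⟩
  · rintro k ⟨Λ, hΛ, rfl⟩
    exact Finset.le_sup (f := fun Λ => Module.finrank ℝ (cosupportSubspace B Λ))
      (Finset.mem_filter.mpr ⟨Finset.mem_univ _, hΛ⟩)

/-- The one-dimensional discrete derivative operator `∂ : ℝ^m → ℝ^(m-1)`,
`(∂ u)_i = u_{i+1} - u_i` (no rows if `m ≤ 1`). -/
def discreteDeriv (m : ℕ) : Matrix (Fin (m - 1)) (Fin m) ℝ :=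
  fun i j => if (j : ℕ) = i then -1 else if (j : ℕ) = i + 1 then 1 else 0

/-- Row indices of the gradient on the grid `[n₁]₀ × [n₂]₀`: one for each edge of the grid graph,
horizontal edges in the first summand and vertical edges in the second. -/
abbrev GradRows₂ (n₁ n₂ : ℕ) : Type :=
  (Fin (n₁ - 1) × Fin n₂) ⊕ (Fin n₁ × Fin (n₂ - 1))

/-- The discrete gradient on the grid `[n₁]₀ × [n₂]₀`, with blocks `∂₁ ⊗ I₂` and `I₁ ⊗ ∂₂`. -/
def grad₂ (n₁ n₂ : ℕ) : Matrix (GradRows₂ n₁ n₂) (Fin n₁ × Fin n₂) ℝ :=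
  Matrix.fromRows
    (discreteDeriv n₁ ⊗ₖ (1 : Matrix (Fin n₂) (Fin n₂) ℝ))
    ((1 : Matrix (Fin n₁) (Fin n₁) ℝ) ⊗ₖ discreteDeriv n₂)

/-- Row indices of the gradient on the grid `[n₁]₀ × [n₂]₀ × [n₃]₀`: one for each edge of the
grid graph, sorted by direction. -/
abbrev GradRows₃ (n₁ n₂ n₃ : ℕ) : Type :=
  (Fin (n₁ - 1) × Fin n₂ × Fin n₃) ⊕
    ((Fin n₁ × Fin (n₂ - 1) × Fin n₃) ⊕ (Fin n₁ × Fin n₂ × Fin (n₃ - 1)))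

/-- The discrete gradient on the grid `[n₁]₀ × [n₂]₀ × [n₃]₀`, with blocks
`∂₁ ⊗ I₂ ⊗ I₃`, `I₁ ⊗ ∂₂ ⊗ I₃` and `I₁ ⊗ I₂ ⊗ ∂₃`. -/
def grad₃ (n₁ n₂ n₃ : ℕ) :
    Matrix (GradRows₃ n₁ n₂ n₃) (Fin n₁ × Fin n₂ × Fin n₃) ℝ :=
  Matrix.fromRows
    (discreteDeriv n₁ ⊗ₖ
      ((1 : Matrix (Fin n₂) (Fin n₂) ℝ) ⊗ₖ (1 : Matrix (Fin n₃) (Fin n₃) ℝ)))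
    (Matrix.fromRows
      ((1 : Matrix (Fin n₁) (Fin n₁) ℝ) ⊗ₖ
        (discreteDeriv n₂ ⊗ₖ (1 : Matrix (Fin n₃) (Fin n₃) ℝ)))
      ((1 : Matrix (Fin n₁) (Fin n₁) ℝ) ⊗ₖ
        ((1 : Matrix (Fin n₂) (Fin n₂) ℝ) ⊗ₖ discreteDeriv n₃)))

end GridGradient

end

/-!
Call two vertices equivalent if every `u ∈ W_Λ` takes the same value at both. Then `dim W_Λ` is at
most the number `c` of classes (`exists_labelling`), and every edge in `Λ` joins two equivalent
vertices. So the task is to bound the number of edges of the grid lying inside the classes in terms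
of `R = n - c`; connectivity of the classes plays no role.

In a fixed coordinate direction, the classes contain at most `n - ∑ₖ |π Sₖ|` edges, where `π` is the
projection along that direction and `Sₖ` runs over the classes: on each line, the lowest point of
a class is not the upper end of an edge of that class (`card_add_sum_card_image_le`). By the
Loomis–Whitney inequality and AM-GM, the `d` projections of a set of size `m` have total size at
least `d * m ^ ((d - 1) / d)`. Since `x ↦ (1 + x) ^ ((d - 1) / d) - 1` is concave and vanishes at
`0`, it is subadditive, so the worst case is that of one large class and singletons
(`le_sum_rpow_card_fiber`). Altogether
`|Λ| ≤ d * (1 + R) - d * (1 + R) ^ ((d - 1) / d)`,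
and solving this for `R` gives the claim. For `d = 2` the solution is exact (`sqrt_inversion`); for
`d = 3` the claimed bound is slightly weaker than the exact solution (`cbrt_inversion`).
-/

open Finset

namespace GridGradient

universe u

/-! ### Edges inside a vertex set and its projections -/

/-- Let the edges `e ∈ E` go upwards, with respect to the height `c`, from `s e` to `t e` within a
fibre of `π`, and let each vertex be the upper end of at most one edge. Then the lowest point of `S`
in each fibre is no upper end, so at most `|S| - |π S|` points of `S` are. -/
theorem card_add_card_image_le {α β ε : Type*} [DecidableEq α] [DecidableEq β]
    (S : Finset α) (π : α → β) (c : α → ℕ) (E : Finset ε) (s t : ε → α)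
    (ht : Set.InjOn t E) (hs : ∀ e ∈ E, s e ∈ S) (htS : ∀ e ∈ E, t e ∈ S)
    (hπ : ∀ e ∈ E, π (s e) = π (t e)) (hc : ∀ e ∈ E, c (s e) < c (t e)) :
    E.card + (S.image π).card ≤ S.card := by
  have hT : E.image t ⊆ S := fun x hx => by
    obtain ⟨e, he, rfl⟩ := mem_image.1 hx
    exact htS e he
  have hsub : S.image π ⊆ (S \ E.image t).image π := by
    intro b hb
    obtain ⟨x, hx, rfl⟩ := mem_image.1 hb
    -- a vertex of least height on the line through `x` is not the upper end of an edge
    obtain ⟨y, hy, hmin⟩ := exists_min_image (S.filter (fun y => π y = π x)) c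
      ⟨x, by simp [hx]⟩
    rw [mem_filter] at hy
    refine mem_image.2 ⟨y, mem_sdiff.2 ⟨hy.1, fun hyT => ?_⟩, hy.2⟩
    obtain ⟨e, he, rfl⟩ := mem_image.1 hyT
    have := hmin (s e) (mem_filter.2 ⟨hs e he, (hπ e he).trans hy.2⟩)
    exact absurd (hc e he) (not_lt.2 this)
  have h1 := (card_le_card hsub).trans card_image_le
  have h2 := card_sdiff_add_card_eq_card hT
  rw [card_image_of_injOn ht] at h2
  omega

/-- The bound `card_add_card_image_le` summed over the classes of the labelling `f`, for edges whose
ends carry the same label. -/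
theorem card_add_sum_card_image_le {V β κ ε : Type*} [Fintype V] [DecidableEq V] [DecidableEq β]
    [Fintype κ] [DecidableEq κ] (f : V → κ) (π : V → β) (c : V → ℕ)
    (E : Finset ε) (s t : ε → V) (ht : Function.Injective t)
    (hf : ∀ e ∈ E, f (s e) = f (t e)) (hπ : ∀ e, π (s e) = π (t e))
    (hc : ∀ e, c (s e) < c (t e)) :
    E.card + ∑ k, ((univ.filter (fun v => f v = k)).image π).card ≤ Fintype.card V := by
  -- the fibres of `v ↦ (f v, π v)` are the fibres of `π` in the separate classes
  have h := card_add_card_image_le univ (fun v => (f v, π v)) c E s t ht.injOn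
    (fun _ _ => mem_univ _) (fun _ _ => mem_univ _)
    (fun e he => Prod.ext (hf e he) (hπ e)) (fun e _ => hc e)
  rw [card_eq_sum_card_fiberwise (f := Prod.fst) (t := univ) (fun _ _ => mem_coe.2 (mem_univ _))] at h
  refine le_trans (Nat.add_le_add_left (sum_le_sum fun k _ => ?_) _) h
  rw [← card_image_of_injective _ (Prod.mk_right_injective k)]
  refine card_le_card fun x hx => ?_
  simp only [mem_image, mem_filter, mem_univ, true_and] at hx ⊢
  obtain ⟨_, ⟨v, rfl, rfl⟩, rfl⟩ := hx
  exact ⟨⟨v, rfl⟩, rfl⟩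

/-! ### Isoperimetry: projections of finite sets -/

theorem card_le_card_image_mul_card_image {α β : Type*} [DecidableEq α] [DecidableEq β]
    (S : Finset (α × β)) : S.card ≤ (S.image Prod.snd).card * (S.image Prod.fst).card := by
  rw [mul_comm, ← card_product]
  exact card_le_card fun x hx =>
    mem_product.2 ⟨mem_image_of_mem _ hx, mem_image_of_mem _ hx⟩

/-- The discrete Loomis–Whitney inequality in dimension three: Cauchy–Schwarz over the lines in the
first direction bounds `|S| ^ 2` by the first projection times the number of pairs of points of `S`
on a common line, and such a pair is determined by one point of each of the other projections. -/
theorem loomis_whitney {α β γ : Type*} [DecidableEq α] [DecidableEq β] [DecidableEq γ]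
    (S : Finset (α × β × γ)) :
    S.card ^ 2 ≤ (S.image (fun v => v.2)).card * (S.image (fun v => (v.1, v.2.2))).card *
      (S.image (fun v => (v.1, v.2.1))).card := by
  have hcs : S.card ^ 2 ≤ (S.image (fun v => v.2)).card *
      ∑ b ∈ S.image (fun v => v.2), (S.filter (fun v => v.2 = b)).card ^ 2 := by
    conv_lhs => rw [card_eq_sum_card_image (fun v => v.2) S]
    exact sq_sum_le_card_mul_sum_sq
  refine hcs.trans ?_
  rw [mul_assoc]
  refine Nat.mul_le_mul_left _ ?_
  -- the sum counts the pairs of points of `S` on a common line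
  have hpairs : ∑ b ∈ S.image (fun v => v.2), (S.filter (fun v => v.2 = b)).card ^ 2 =
      ((S.image (fun v => v.2)).sigma (fun b => (S.filter (fun v => v.2 = b)) ×ˢ
        (S.filter (fun v => v.2 = b)))).card := by
    rw [card_sigma]
    exact sum_congr rfl fun b _ => by rw [card_product, sq]
  rw [hpairs, ← card_product]
  refine card_le_card_of_injOn
    (fun x => ((x.2.1.1, x.2.1.2.2), (x.2.2.1, x.2.2.2.1))) ?_ ?_
  · rintro ⟨b, v, w⟩ h
    simp only [coe_sigma, Set.mem_sigma_iff, mem_coe, mem_product, mem_filter] at h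
    exact mem_coe.2 (mem_product.2 ⟨mem_image_of_mem (fun v => (v.1, v.2.2)) h.2.1.1,
      mem_image_of_mem (fun v => (v.1, v.2.1)) h.2.2.1⟩)
  · rintro ⟨⟨b₁, b₂⟩, ⟨x, y, z⟩, ⟨x', y', z'⟩⟩ h ⟨⟨b₁', b₂'⟩, ⟨u, v, w⟩, ⟨u', v', w'⟩⟩ h' he
    simp only [coe_sigma, Set.mem_sigma_iff, mem_coe, mem_product, mem_filter, Prod.mk.injEq] at h h' he
    grind

theorem two_mul_rpow_le_add {m a b : ℕ} (h : m ≤ a * b) :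
    2 * (m : ℝ) ^ (1 / 2 : ℝ) ≤ a + b := by
  rw [← Real.sqrt_eq_rpow]
  have h' : (m : ℝ) ≤ a * b := by exact_mod_cast h
  have hs := Real.sq_sqrt (Nat.cast_nonneg (α := ℝ) m)
  refine abs_le_of_sq_le_sq' ?_ (by positivity) |>.2
  nlinarith [sq_nonneg ((a : ℝ) - b)]

theorem three_mul_rpow_le_add {m a b c : ℕ} (h : m ^ 2 ≤ a * b * c) :
    3 * (m : ℝ) ^ (2 / 3 : ℝ) ≤ a + b + c := by
  have h' : (m : ℝ) ^ 2 ≤ a * b * c := by exact_mod_cast h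
  have hw : ((m : ℝ) ^ (2 / 3 : ℝ)) ^ 3 = (m : ℝ) ^ 2 := by
    rw [← Real.rpow_mul_natCast (Nat.cast_nonneg m), ← Real.rpow_natCast]
    norm_num
  refine le_of_pow_le_pow_left₀ three_ne_zero (by positivity) ?_
  rw [mul_pow, hw]
  have amgm : ∀ x y z : ℝ, 0 ≤ x → 0 ≤ y → 0 ≤ z → 27 * (x * y * z) ≤ (x + y + z) ^ 3 := by
    intro x y z hx hy hz
    nlinarith [mul_nonneg hx (sq_nonneg (y - z)), mul_nonneg hy (sq_nonneg (x - z)),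
      mul_nonneg hz (sq_nonneg (x - y)), mul_nonneg hx (sq_nonneg (x - y)),
      mul_nonneg hx (sq_nonneg (x - z)), mul_nonneg hy (sq_nonneg (x - y)),
      mul_nonneg hy (sq_nonneg (y - z)), mul_nonneg hz (sq_nonneg (x - z)),
      mul_nonneg hz (sq_nonneg (y - z))]
  linarith [amgm a b c (by positivity) (by positivity) (by positivity)]

/-! ### Merging the classes -/

/-- A concave function vanishing at `0` is subadditive: `1 + a` and `1 + b` are complementary convex
combinations of `1` and `1 + (a + b)`. -/
theorem one_add_rpow_subadditive {p : ℝ} (hp0 : 0 ≤ p) (hp1 : p ≤ 1) {a b : ℝ}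
    (ha : 0 ≤ a) (hb : 0 ≤ b) :
    (1 + (a + b)) ^ p - 1 ≤ ((1 + a) ^ p - 1) + ((1 + b) ^ p - 1) := by
  rcases eq_or_lt_of_le (add_nonneg ha hb) with h0 | h0
  · have ha0 : a = 0 := by linarith
    have hb0 : b = 0 := by linarith
    simp [ha0, hb0]
  have hc := (Real.concaveOn_rpow hp0 hp1).2
  have m1 : (1 : ℝ) ∈ Set.Ici (0 : ℝ) := by simp
  have m2 : 1 + (a + b) ∈ Set.Ici (0 : ℝ) := by simp only [Set.mem_Ici]; linarith
  have hab : b / (a + b) + a / (a + b) = 1 := by field_simp; ring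
  have k1 := hc m1 m2 (div_nonneg hb h0.le) (div_nonneg ha h0.le) hab
  have k2 := hc m1 m2 (div_nonneg ha h0.le) (div_nonneg hb h0.le) (by rw [add_comm]; exact hab)
  simp only [smul_eq_mul, Real.one_rpow, mul_one] at k1 k2
  have e1 : b / (a + b) + a / (a + b) * (1 + (a + b)) = 1 + a := by field_simp; ring
  have e2 : a / (a + b) + b / (a + b) * (1 + (a + b)) = 1 + b := by field_simp; ring
  rw [e1] at k1
  rw [e2] at k2
  have hX : (b / (a + b) + a / (a + b)) * (1 + (1 + (a + b)) ^ p) =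
      1 + (1 + (a + b)) ^ p := by rw [hab, one_mul]
  linarith

/-- For given `|V|` and `|κ|`, the sum of the powers of the class sizes is at least its value for
one class of size `1 + (|V| - |κ|)` and singletons otherwise. -/
theorem le_sum_rpow_card_fiber {V κ : Type*} [Fintype V] [Fintype κ] [DecidableEq κ]
    {f : V → κ} (hf : Function.Surjective f) {p : ℝ} (hp0 : 0 ≤ p) (hp1 : p ≤ 1) :
    (Fintype.card κ : ℝ) + (1 + ((Fintype.card V : ℝ) - Fintype.card κ)) ^ p - 1 ≤
      ∑ k, ((univ.filter (fun v => f v = k)).card : ℝ) ^ p := by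
  have hpos : ∀ k, (0 : ℝ) ≤ ((univ.filter (fun v => f v = k)).card : ℝ) - 1 := fun k => by
    obtain ⟨v, hv⟩ := hf k
    have : 1 ≤ (univ.filter (fun v => f v = k)).card := card_pos.2 ⟨v, by simp [hv]⟩
    have : (1 : ℝ) ≤ ((univ.filter (fun v => f v = k)).card : ℝ) := by exact_mod_cast this
    linarith
  have hV : (Fintype.card V : ℝ) = ∑ k, ((univ.filter (fun v => f v = k)).card : ℝ) := by
    rw [← card_univ, card_eq_sum_card_fiberwise (f := f) (t := univ)
      (fun _ _ => mem_coe.2 (mem_univ _))]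
    push_cast; rfl
  have key := le_sum_of_subadditive_on_pred (fun x : ℝ => (1 + x) ^ p - 1) (fun x => 0 ≤ x)
    (by simp) (fun x y hx hy => one_add_rpow_subadditive hp0 hp1 hx hy)
    (fun x y hx hy => add_nonneg hx hy)
    (fun k => ((univ.filter (fun v => f v = k)).card : ℝ) - 1) (s := univ) (fun k _ => hpos k)
  simp only [add_sub_cancel, sum_sub_distrib, sum_const, card_univ, nsmul_eq_mul, mul_one] at key
  rw [hV]
  linarith

/-! ### From the null space to a partition of the vertices -/

/-- The labels are the classes of points not separated by `W`; the elements of `W` factor through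
the labelling, which bounds the dimension. -/
theorem exists_labelling {V : Type u} [Fintype V] (W : Submodule ℝ (V → ℝ)) :
    ∃ (κ : Type u) (_ : Fintype κ) (_ : DecidableEq κ) (f : V → κ), Function.Surjective f ∧
      Module.finrank ℝ W ≤ Fintype.card κ ∧
      ∀ v v', (∀ w ∈ W, w v = w v') → f v = f v' := by
  classical
  let r : Setoid V := Setoid.ker (fun v (w : W) => (w : V → ℝ) v)
  refine ⟨Quotient r, inferInstance, inferInstance, Quotient.mk r, Quotient.mk_surjective, ?_,
    fun v v' h => Quotient.sound (s := r) (funext fun w => h w w.2)⟩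
  have hle : W ≤ LinearMap.range (LinearMap.funLeft ℝ ℝ (Quotient.mk r)) := fun w hw =>
    ⟨Quotient.lift w fun a b hab => congrFun hab ⟨w, hw⟩, rfl⟩
  have h1 := Submodule.finrank_mono hle
  have h2 := LinearMap.finrank_range_le (LinearMap.funLeft ℝ ℝ (Quotient.mk r))
  rw [Module.finrank_fintype_fun_eq_card] at h2
  exact h1.trans h2

/-! ### Rows of the gradient -/

theorem sum_discreteDeriv_mul {m : ℕ} (i : Fin (m - 1)) (g : Fin m → ℝ) :
    ∑ a, discreteDeriv m i a * g a =
      g ⟨i + 1, by omega⟩ - g ⟨i, by omega⟩ := by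
  have h : ∀ a, discreteDeriv m i a * g a =
      (if a = (⟨i + 1, by omega⟩ : Fin m) then g a else 0) -
        (if a = (⟨i, by omega⟩ : Fin m) then g a else 0) := by
    intro a
    simp only [discreteDeriv, Fin.ext_iff]
    split_ifs <;> first | omega | ring
  simp only [h, sum_sub_distrib, sum_ite_eq', mem_univ, if_true]

theorem mem_cosupportSubspace {P N : Type*} [Fintype N] {B : Matrix P N ℝ} {Λ : Finset P}
    {u : N → ℝ} : u ∈ cosupportSubspace B Λ ↔ ∀ r ∈ Λ, ∑ v, B r v * u v = 0 := by
  simp only [cosupportSubspace, LinearMap.mem_ker, Matrix.mulVecLin_apply, funext_iff,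
    Subtype.forall, Matrix.mulVec, dotProduct, Matrix.submatrix_apply, id, Pi.zero_apply]

section rows

variable {n₁ n₂ n₃ : ℕ}

theorem grad₂_inl (i : Fin (n₁ - 1)) (j : Fin n₂) (u : Fin n₁ × Fin n₂ → ℝ) :
    ∑ v, grad₂ n₁ n₂ (Sum.inl (i, j)) v * u v =
      u (⟨i + 1, by omega⟩, j) - u (⟨i, by omega⟩, j) := by
  rw [← sum_discreteDeriv_mul i (fun a => u (a, j)), Fintype.sum_prod_type]
  simp [grad₂, Matrix.kroneckerMap_apply, Matrix.one_apply]

theorem grad₂_inr (i : Fin n₁) (j : Fin (n₂ - 1)) (u : Fin n₁ × Fin n₂ → ℝ) :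
    ∑ v, grad₂ n₁ n₂ (Sum.inr (i, j)) v * u v =
      u (i, ⟨j + 1, by omega⟩) - u (i, ⟨j, by omega⟩) := by
  rw [← sum_discreteDeriv_mul j (fun b => u (i, b)), Fintype.sum_prod_type_right]
  simp [grad₂, Matrix.kroneckerMap_apply, Matrix.one_apply]

theorem grad₃_inl (i : Fin (n₁ - 1)) (j : Fin n₂) (k : Fin n₃)
    (u : Fin n₁ × Fin n₂ × Fin n₃ → ℝ) :
    ∑ v, grad₃ n₁ n₂ n₃ (Sum.inl (i, j, k)) v * u v =
      u (⟨i + 1, by omega⟩, j, k) - u (⟨i, by omega⟩, j, k) := by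
  rw [← sum_discreteDeriv_mul i (fun a => u (a, j, k))]
  simp [grad₃, Matrix.kroneckerMap_apply, Matrix.one_apply, Fintype.sum_prod_type]

theorem grad₃_inr_inl (i : Fin n₁) (j : Fin (n₂ - 1)) (k : Fin n₃)
    (u : Fin n₁ × Fin n₂ × Fin n₃ → ℝ) :
    ∑ v, grad₃ n₁ n₂ n₃ (Sum.inr (Sum.inl (i, j, k))) v * u v =
      u (i, ⟨j + 1, by omega⟩, k) - u (i, ⟨j, by omega⟩, k) := by
  rw [← sum_discreteDeriv_mul j (fun b => u (i, b, k)), Fintype.sum_prod_type_right]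
  simp [grad₃, Matrix.kroneckerMap_apply, Matrix.one_apply, Fintype.sum_prod_type]

theorem grad₃_inr_inr (i : Fin n₁) (j : Fin n₂) (k : Fin (n₃ - 1))
    (u : Fin n₁ × Fin n₂ × Fin n₃ → ℝ) :
    ∑ v, grad₃ n₁ n₂ n₃ (Sum.inr (Sum.inr (i, j, k))) v * u v =
      u (i, j, ⟨k + 1, by omega⟩) - u (i, j, ⟨k, by omega⟩) := by
  rw [← sum_discreteDeriv_mul k (fun c => u (i, j, c)), Fintype.sum_prod_type_right]
  simp [grad₃, Matrix.kroneckerMap_apply, Matrix.one_apply, Fintype.sum_prod_type_right]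

end rows

/-! ### Number of edges in terms of the codimension -/

/-- `R` is the number of vertices minus the number of classes of `exists_labelling`. -/
theorem exists_rank_bound_grad₂ (q : ℕ) (Λ : Finset (GradRows₂ q q)) :
    ∃ R : ℝ, 0 ≤ R ∧ Module.finrank ℝ (cosupportSubspace (grad₂ q q) Λ) ≤ (q : ℝ) ^ 2 - R ∧
      (Λ.card : ℝ) ≤ 2 * (1 + R) - 2 * (1 + R) ^ (1 / 2 : ℝ) := by
  obtain ⟨κ, _, _, f, hf, hdim, hfW⟩ := exists_labelling (cosupportSubspace (grad₂ q q) Λ)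
  have hdim' : (Module.finrank ℝ (cosupportSubspace (grad₂ q q) Λ) : ℝ) ≤ Fintype.card κ := by
    exact_mod_cast hdim
  have hcard : Fintype.card κ ≤ Fintype.card (Fin q × Fin q) := Fintype.card_le_of_surjective f hf
  have hV : Fintype.card (Fin q × Fin q) = q ^ 2 := by simp [sq]
  have hcard' : (Fintype.card κ : ℝ) ≤ (q : ℝ) ^ 2 := by exact_mod_cast hV ▸ hcard
  have h1 := card_add_sum_card_image_le f Prod.snd (fun v => (v.1 : ℕ)) Λ.toLeft
    (fun e => (⟨e.1, by omega⟩, e.2)) (fun e => (⟨e.1 + 1, by omega⟩, e.2))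
    (fun a b h => by
      simp only [Prod.ext_iff, Fin.ext_iff] at h ⊢; omega)
    (fun e he => hfW _ _ fun w hw => by
      have := mem_cosupportSubspace.1 hw _ (mem_toLeft.1 he)
      rw [grad₂_inl] at this
      linarith) (fun e => rfl) (fun e => Nat.lt_succ_self _)
  have h2 := card_add_sum_card_image_le f Prod.fst (fun v => (v.2 : ℕ)) Λ.toRight
    (fun e => (e.1, ⟨e.2, by omega⟩)) (fun e => (e.1, ⟨e.2 + 1, by omega⟩))
    (fun a b h => by
      simp only [Prod.ext_iff, Fin.ext_iff] at h ⊢; omega)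
    (fun e he => hfW _ _ fun w hw => by
      have := mem_cosupportSubspace.1 hw _ (mem_toRight.1 he)
      rw [grad₂_inr] at this
      linarith) (fun e => rfl) (fun e => Nat.lt_succ_self _)
  have hΛ := card_toLeft_add_card_toRight (u := Λ)
  have hiso := sum_le_sum fun k (_ : k ∈ (univ : Finset κ)) => two_mul_rpow_le_add
    (card_le_card_image_mul_card_image (univ.filter (fun v => f v = k)))
  have hconc := le_sum_rpow_card_fiber hf (p := 1 / 2) (by norm_num) (by norm_num)
  rw [hV] at h1 h2 hconc
  have htot : (Λ.card : ℝ) + ∑ k, ((((univ.filter (fun v => f v = k)).image Prod.snd).card : ℝ) +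
      ((univ.filter (fun v => f v = k)).image Prod.fst).card) ≤ 2 * (q : ℝ) ^ 2 := by
    rw [sum_add_distrib]
    exact_mod_cast (by omega)
  rw [← mul_sum] at hiso
  push_cast at hconc
  exact ⟨(q : ℝ) ^ 2 - Fintype.card κ, by linarith, by linarith, by linarith⟩

/-- `R` is the number of vertices minus the number of classes of `exists_labelling`. -/
theorem exists_rank_bound_grad₃ (q : ℕ) (Λ : Finset (GradRows₃ q q q)) :
    ∃ R : ℝ, 0 ≤ R ∧ Module.finrank ℝ (cosupportSubspace (grad₃ q q q) Λ) ≤ (q : ℝ) ^ 3 - R ∧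
      (Λ.card : ℝ) ≤ 3 * (1 + R) - 3 * (1 + R) ^ (2 / 3 : ℝ) := by
  obtain ⟨κ, _, _, f, hf, hdim, hfW⟩ := exists_labelling (cosupportSubspace (grad₃ q q q) Λ)
  have hdim' : (Module.finrank ℝ (cosupportSubspace (grad₃ q q q) Λ) : ℝ) ≤ Fintype.card κ := by
    exact_mod_cast hdim
  have hcard : Fintype.card κ ≤ Fintype.card (Fin q × Fin q × Fin q) :=
    Fintype.card_le_of_surjective f hf
  have hV : Fintype.card (Fin q × Fin q × Fin q) = q ^ 3 := by simp; ring
  have hcard' : (Fintype.card κ : ℝ) ≤ (q : ℝ) ^ 3 := by exact_mod_cast hV ▸ hcard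
  have h1 := card_add_sum_card_image_le f (fun v => v.2) (fun v => (v.1 : ℕ)) Λ.toLeft
    (fun e => (⟨e.1, by omega⟩, e.2)) (fun e => (⟨e.1 + 1, by omega⟩, e.2))
    (fun a b h => by
      simp only [Prod.ext_iff, Fin.ext_iff] at h ⊢; omega)
    (fun e he => hfW _ _ fun w hw => by
      have := mem_cosupportSubspace.1 hw _ (mem_toLeft.1 he)
      rw [grad₃_inl] at this
      linarith) (fun e => rfl) (fun e => Nat.lt_succ_self _)
  have h2 := card_add_sum_card_image_le f (fun v => (v.1, v.2.2)) (fun v => (v.2.1 : ℕ))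
    Λ.toRight.toLeft
    (fun e => (e.1, ⟨e.2.1, by omega⟩, e.2.2)) (fun e => (e.1, ⟨e.2.1 + 1, by omega⟩, e.2.2))
    (fun a b h => by
      simp only [Prod.ext_iff, Fin.ext_iff] at h ⊢; omega)
    (fun e he => hfW _ _ fun w hw => by
      have := mem_cosupportSubspace.1 hw _ (mem_toRight.1 (mem_toLeft.1 he))
      rw [grad₃_inr_inl] at this
      linarith) (fun e => rfl) (fun e => Nat.lt_succ_self _)
  have h3 := card_add_sum_card_image_le f (fun v => (v.1, v.2.1)) (fun v => (v.2.2 : ℕ))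
    Λ.toRight.toRight
    (fun e => (e.1, e.2.1, ⟨e.2.2, by omega⟩)) (fun e => (e.1, e.2.1, ⟨e.2.2 + 1, by omega⟩))
    (fun a b h => by
      simp only [Prod.ext_iff, Fin.ext_iff] at h ⊢; omega)
    (fun e he => hfW _ _ fun w hw => by
      have := mem_cosupportSubspace.1 hw _ (mem_toRight.1 (mem_toRight.1 he))
      rw [grad₃_inr_inr] at this
      linarith) (fun e => rfl) (fun e => Nat.lt_succ_self _)
  have hΛ := card_toLeft_add_card_toRight (u := Λ)
  have hΛ' := card_toLeft_add_card_toRight (u := Λ.toRight)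
  have hiso := sum_le_sum fun k (_ : k ∈ (univ : Finset κ)) => three_mul_rpow_le_add
    (loomis_whitney (univ.filter (fun v => f v = k)))
  have hconc := le_sum_rpow_card_fiber hf (p := 2 / 3) (by norm_num) (by norm_num)
  rw [hV] at h1 h2 h3 hconc
  have htot : (Λ.card : ℝ) + ∑ k,
      ((((univ.filter (fun v => f v = k)).image (fun v => v.2)).card : ℝ) +
      ((univ.filter (fun v => f v = k)).image (fun v => (v.1, v.2.2))).card +
      ((univ.filter (fun v => f v = k)).image (fun v => (v.1, v.2.1))).card) ≤
        3 * (q : ℝ) ^ 3 := by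
    rw [sum_add_distrib, sum_add_distrib]
    exact_mod_cast (by omega)
  rw [← mul_sum] at hiso
  push_cast at hconc
  exact ⟨(q : ℝ) ^ 3 - Fintype.card κ, by linarith, by linarith, by linarith⟩

/-! ### Solving for the codimension -/

/-- With `y = √(1 + R)`, the hypothesis `x ≤ 2 * y ^ 2 - 2 * y` says `1 + 2 * x ≤ (2 * y - 1) ^ 2`. -/
theorem sqrt_inversion {x R : ℝ} (hR : 0 ≤ R)
    (h : x ≤ 2 * (1 + R) - 2 * (1 + R) ^ (1 / 2 : ℝ)) :
    1 / 2 * (x + Real.sqrt (1 + 2 * x)) - 1 / 2 ≤ R := by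
  rw [← Real.sqrt_eq_rpow] at h
  have hs : 1 ≤ √(1 + R) := Real.one_le_sqrt.2 (by linarith)
  have hsq := Real.sq_sqrt (show 0 ≤ 1 + R by linarith)
  have : √(1 + 2 * x) ≤ 2 * √(1 + R) - 1 :=
    Real.sqrt_le_iff.2 ⟨by linarith, by nlinarith⟩
  linarith

/-- The case `s = (1 + R) ^ (1 / 3)`, `t = (x / 3) ^ (1 / 3)` is the inequality to which
`cbrt_inversion` reduces. With `Q` the left side of the conclusion, it holds because
`Q ^ 3 < (t ^ 3 + Q) ^ 2`, a polynomial in `t` with positive coefficients being the difference. -/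
theorem sq_bound_of_cube_le {s t : ℝ} (hs : 1 ≤ s) (ht : 0 ≤ t) (h : t ^ 3 ≤ s ^ 3 - s ^ 2) :
    t ^ 2 + 2 / 3 * t + 1 / 3 ≤ s ^ 2 := by
  by_contra! hlt
  set Q := t ^ 2 + 2 / 3 * t + 1 / 3 with hQ
  have hQ0 : 0 ≤ Q := by positivity
  have hs0 : s < √Q := Real.lt_sqrt_of_sq_lt hlt
  have hsq := Real.sq_sqrt hQ0
  -- `s ↦ s ^ 3 - s ^ 2` is increasing for `1 ≤ s`, so the hypothesis passes from `s` to `√Q`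
  have hmono : s ^ 3 - s ^ 2 ≤ √Q ^ 3 - √Q ^ 2 := by
    have h1 : s ^ 2 * (s - 1) ≤ √Q ^ 2 * (√Q - 1) :=
      mul_le_mul (by rw [hsq]; exact hlt.le) (by linarith) (by linarith) (by positivity)
    linarith
  have h1 : t ^ 3 + Q ≤ √Q * Q := by
    have : √Q ^ 3 = √Q * Q := by rw [pow_succ, hsq, mul_comm]
    linarith
  have h2 : (t ^ 3 + Q) ^ 2 ≤ Q ^ 3 := by
    calc (t ^ 3 + Q) ^ 2 ≤ (√Q * Q) ^ 2 := pow_le_pow_left₀ (by positivity) h1 2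
      _ = Q ^ 3 := by rw [mul_pow, hsq]; ring
  have h3 : (t ^ 3 + Q) ^ 2 - Q ^ 3 = 10 / 27 * t ^ 3 + 1 / 3 * t ^ 2 + 2 / 9 * t + 2 / 27 := by
    rw [hQ]; ring
  have : 0 < 10 / 27 * t ^ 3 + 1 / 3 * t ^ 2 + 2 / 9 * t + 2 / 27 := by positivity
  linarith

theorem cbrt_inversion {x R : ℝ} (hx : 0 ≤ x) (hR : 0 ≤ R)
    (h : x ≤ 3 * (1 + R) - 3 * (1 + R) ^ (2 / 3 : ℝ)) :
    1 / 3 * (x + (3 * x ^ 2) ^ ((1 : ℝ) / 3) + 2 * (x / 3) ^ ((1 : ℝ) / 3)) - 2 / 3 ≤ R := by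
  have hx3 : 0 ≤ x / 3 := by positivity
  have hR1 : 0 ≤ 1 + R := by linarith
  have ht : 0 ≤ (x / 3) ^ ((1 : ℝ) / 3) := by positivity
  have hs : 1 ≤ (1 + R) ^ ((1 : ℝ) / 3) := Real.one_le_rpow (by linarith) (by norm_num)
  have hs3 : ((1 + R) ^ ((1 : ℝ) / 3)) ^ 3 = 1 + R := by
    rw [← Real.rpow_mul_natCast hR1]; norm_num
  have hs2 : ((1 + R) ^ ((1 : ℝ) / 3)) ^ 2 = (1 + R) ^ (2 / 3 : ℝ) := by
    rw [← Real.rpow_mul_natCast hR1]; norm_num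
  have ht3 : ((x / 3) ^ ((1 : ℝ) / 3)) ^ 3 = x / 3 := by
    rw [← Real.rpow_mul_natCast hx3]; norm_num
  have ht2 : (3 * x ^ 2) ^ ((1 : ℝ) / 3) = 3 * ((x / 3) ^ ((1 : ℝ) / 3)) ^ 2 := by
    have : 3 * x ^ 2 = (3 * ((x / 3) ^ ((1 : ℝ) / 3)) ^ 2) ^ 3 := by
      calc 3 * x ^ 2 = 27 * (x / 3) ^ 2 := by ring
        _ = 27 * (((x / 3) ^ ((1 : ℝ) / 3)) ^ 3) ^ 2 := by rw [ht3]
        _ = _ := by ring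
    rw [this, ← Real.rpow_natCast _ 3, ← Real.rpow_mul (by positivity)]
    norm_num
  have key := sq_bound_of_cube_le hs ht (by rw [ht3, hs3, hs2]; linarith)
  rw [hs2] at key
  rw [ht2]
  linarith

end GridGradient

theorem mainTheorem1 (q : ℕ) :
    (∀ ℓ : ℕ, 4 < ℓ → ℓ ≤ Fintype.card (GridGradient.GradRows₂ q q) →
      (GridGradient.kappa (GridGradient.grad₂ q q) ℓ : ℝ) ≤
        (q : ℝ) ^ 2 - 1 / 2 * ((ℓ : ℝ) + Real.sqrt (1 + 2 * (ℓ : ℝ))) + 1 / 2) ∧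
    (∀ ℓ : ℕ, 54 < ℓ → ℓ ≤ Fintype.card (GridGradient.GradRows₃ q q q) →
      (GridGradient.kappa (GridGradient.grad₃ q q q) ℓ : ℝ) ≤
        (q : ℝ) ^ 3 - 1 / 3 * ((ℓ : ℝ) + (3 * (ℓ : ℝ) ^ 2) ^ ((1 : ℝ) / 3)
          + 2 * ((ℓ : ℝ) / 3) ^ ((1 : ℝ) / 3)) + 2 / 3) := by
  refine ⟨fun ℓ _ hℓ => ?_, fun ℓ _ hℓ => ?_⟩
  · obtain ⟨Λ, hΛ, hκ⟩ := (GridGradient.kappa_isGreatest (GridGradient.grad₂ q q) ℓ hℓ).1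
    obtain ⟨R, hR, hdim, hcard⟩ := GridGradient.exists_rank_bound_grad₂ q Λ
    rw [hκ] at hdim
    have hΛ' : (ℓ : ℝ) ≤ Λ.card := by exact_mod_cast hΛ
    linarith [GridGradient.sqrt_inversion hR (hΛ'.trans hcard)]
  · obtain ⟨Λ, hΛ, hκ⟩ := (GridGradient.kappa_isGreatest (GridGradient.grad₃ q q q) ℓ hℓ).1
    obtain ⟨R, hR, hdim, hcard⟩ := GridGradient.exists_rank_bound_grad₃ q Λ
    rw [hκ] at hdim
    have hΛ' : (ℓ : ℝ) ≤ Λ.card := by exact_mod_cast hΛ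
    linarith [GridGradient.cbrt_inversion (Nat.cast_nonneg ℓ) hR (hΛ'.trans hcard)]
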